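/- A convex body is a compact convex set with nonempty interior. For a convex body $T\subset\mathbb R^n$ put $\|q\|_T=\max_{p\in T}\langle p,q\rangle$, and let $\ell_T(q_1,\dots,q_m)=\sum_{i=1}^m\|q_{i+1}-q_i\|_T$ (with $q_{m+1}=q_1$) be the length of a closed polygonal line. For a convex body $K\subset\mathbb R^n$ let $\mathcal P_m(K)$ be the set of $m$-tuples of points of $\mathbb R^n$ that are not contained in any translate of $\operatorname{int}K$, and let $$\xi_T(K)=\min_{m\ge 2}\ \min_{Q\in\mathcal P_m(K)}\ell_T(Q).$$ Let $n\ge 1$, and let $K,T\subset\mathbb R^n$ be convex bodies. Then the minima defining $\xi_T(K)$ and $\xi_T(K-K)$ are attained, and $$\xi_T(K-K)\le (n+1)\,\xi_T(K).$$ In $\mathbb R^2$ this estimate is sharp: $3$ is the least constant $c$ such that $\xi_T(K-K)\le c\,\xi_T(K)$ for all convex bodies $K,T\subset\mathbb R^2$. Moreover, if $K\subset\mathbb R^2$ is an equilateral triangle with centre at the origin and $K^\circ=\{p:\langle p,q\rangle\le 1\text{ for all }q\in K\}$ is its polar, then $K$ and $K^\circ$ are convex bodies, $\xi_{K^\circ}(K)>0$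 and $\xi_{K^\circ}(K-K)=3\,\xi_{K^\circ}(K)$. -/

import Mathlib

open scoped Pointwise

noncomputable section

namespace FinslerBilliard

/-- Convex bodies: compact convex sets with nonempty interior. -/
structure IsConvexBody {n : ℕ} (K : Set (EuclideanSpace ℝ (Fin n))) : Prop where
  convex : Convex ℝ K
  isCompact : IsCompact K
  interior_nonempty : (interior K).Nonempty

/-- The (one-sided) polar `K° = {p | ⟨p, q⟩ ≤ 1 for all q ∈ K}`. -/
def polarBody {n : ℕ} (K : Set (EuclideanSpace ℝ (Fin n))) : Set (EuclideanSpace ℝ (Fin n)) :=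
  {p | ∀ q ∈ K, inner ℝ p q ≤ 1}

/-- The possibly non-symmetric norm `‖q‖_T = max_{p ∈ T} ⟨p, q⟩`
(for a convex body `T` the supremum is a maximum). -/
def finslerNorm {n : ℕ} (T : Set (EuclideanSpace ℝ (Fin n)))
    (q : EuclideanSpace ℝ (Fin n)) : ℝ :=
  sSup ((fun p => inner ℝ p q) '' T)

/-- The length `∑ ‖q_{i+1} - q_i‖_T` of the closed polygonal line `q_1, …, q_m, q_1`;
`finRotate m` is the cyclic shift `i ↦ i + 1` of the indices. -/
def closedLength {n m : ℕ} (T : Set (EuclideanSpace ℝ (Fin n)))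
    (q : Fin m → EuclideanSpace ℝ (Fin n)) : ℝ :=
  ∑ i, finslerNorm T (q (finRotate m i) - q i)

/-- `P_m(K)`: the `m`-tuples of points that do not fit into any translate of the interior
of `K`. -/
def nonFitting {n : ℕ} (m : ℕ) (K : Set (EuclideanSpace ℝ (Fin n))) :
    Set (Fin m → EuclideanSpace ℝ (Fin n)) :=
  {q | ¬ ∃ t : EuclideanSpace ℝ (Fin n), Set.range q ⊆ t +ᵥ interior K}

/-- The lengths of all closed polygonal lines with `m ≥ 2` vertices that do not fit into any
translate of the interior of `K`. -/
def lengthSet {n : ℕ} (T K : Set (EuclideanSpace ℝ (Fin n))) : Set ℝ :=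
  {L | ∃ m : ℕ, 2 ≤ m ∧ ∃ q ∈ nonFitting m K, closedLength T q = L}

/-- `ξ_T(K) = min_{m ≥ 2} min_{Q ∈ P_m(K)} ℓ_T(Q)`. -/
def xi {n : ℕ} (T K : Set (EuclideanSpace ℝ (Fin n))) : ℝ :=
  sInf (lengthSet T K)

end FinslerBilliard

end

/-! A tuple `q` fits into a translate of `interior K` iff the convex sets `{t | q j - t ∈ interior
K}` have a common point, so by Helly `n + 1` vertices already witness non-fitting. Deleting the
others does not lengthen the line (triangle inequality), and with exactly `n + 1` vertices
compactness gives a minimizer.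

For the estimate, Minkowski's asymmetry bound puts `-K` in a translate of `n K`, hence `K - K` in a
translate of `(n + 1) K`. A minimizer for `K`, dilated by `n + 1`, therefore does not fit `K - K`.

For sharpness, the triangle is described by `y i = ⟨u i, x⟩`, which sum to zero: it is `y i ≤ 1`,
its difference body contains the hexagon `|y i| < 3` in its interior, and the polar norm dominates
`max y i`. A line with edges `v 0, v 1, v 2` gives `ξ(K) ≤ 3`, while three-vertex lines shorter than
9 fit the open hexagon, so `9 ≤ ξ(K - K) ≤ 3 ξ(K) ≤ 9`. -/

namespace FinslerBilliard

variable {n : ℕ} {K T : Set (EuclideanSpace ℝ (Fin n))}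

/-! ### The asymmetric norm of a convex body -/

theorem IsConvexBody.nonempty (hT : IsConvexBody T) : T.Nonempty :=
  hT.interior_nonempty.mono interior_subset

theorem IsConvexBody.bddAbove_inner (hT : IsConvexBody T) (q : EuclideanSpace ℝ (Fin n)) :
    BddAbove ((fun p => inner ℝ p q) '' T) :=
  (hT.isCompact.image (by fun_prop)).bddAbove

theorem IsConvexBody.inner_le_finslerNorm (hT : IsConvexBody T) {p : EuclideanSpace ℝ (Fin n)}
    (hp : p ∈ T) (q : EuclideanSpace ℝ (Fin n)) : inner ℝ p q ≤ finslerNorm T q :=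
  le_csSup (hT.bddAbove_inner q) ⟨p, hp, rfl⟩

theorem IsConvexBody.finslerNorm_le (hT : IsConvexBody T) {q : EuclideanSpace ℝ (Fin n)} {c : ℝ}
    (h : ∀ p ∈ T, inner ℝ p q ≤ c) : finslerNorm T q ≤ c := by
  refine csSup_le (hT.nonempty.image _) ?_
  rintro _ ⟨p, hp, rfl⟩
  exact h p hp

theorem IsConvexBody.finslerNorm_zero (hT : IsConvexBody T) : finslerNorm T 0 = 0 := by
  obtain ⟨p, hp⟩ := hT.nonempty
  refine le_antisymm (hT.finslerNorm_le fun p _ => by simp) ?_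
  simpa using hT.inner_le_finslerNorm hp 0

theorem IsConvexBody.finslerNorm_add_le (hT : IsConvexBody T) (a b : EuclideanSpace ℝ (Fin n)) :
    finslerNorm T (a + b) ≤ finslerNorm T a + finslerNorm T b := by
  refine hT.finslerNorm_le fun p hp => ?_
  rw [inner_add_right]
  exact add_le_add (hT.inner_le_finslerNorm hp a) (hT.inner_le_finslerNorm hp b)

theorem IsConvexBody.finslerNorm_smul (hT : IsConvexBody T) {c : ℝ} (hc : 0 < c)
    (a : EuclideanSpace ℝ (Fin n)) : finslerNorm T (c • a) = c * finslerNorm T a := by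
  refine le_antisymm (hT.finslerNorm_le fun p hp => ?_) ?_
  · rw [inner_smul_right]
    exact mul_le_mul_of_nonneg_left (hT.inner_le_finslerNorm hp a) hc.le
  · rw [← le_div_iff₀' hc]
    refine hT.finslerNorm_le fun p hp => ?_
    rw [le_div_iff₀' hc, ← inner_smul_right]
    exact hT.inner_le_finslerNorm hp _

theorem IsConvexBody.continuous_finslerNorm (hT : IsConvexBody T) :
    Continuous (finslerNorm T) := by
  obtain ⟨R, hR⟩ := hT.isCompact.isBounded.exists_norm_le
  have key : ∀ a b, finslerNorm T a - finslerNorm T b ≤ R * ‖a - b‖ := fun a b => by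
    have h := hT.finslerNorm_add_le (a - b) b
    rw [sub_add_cancel] at h
    have h' : finslerNorm T (a - b) ≤ R * ‖a - b‖ := hT.finslerNorm_le fun p hp =>
      (real_inner_le_norm _ _).trans (mul_le_mul_of_nonneg_right (hR p hp) (norm_nonneg _))
    linarith
  have hR0 : 0 ≤ R := by
    obtain ⟨p, hp⟩ := hT.nonempty
    exact (norm_nonneg p).trans (hR p hp)
  refine LipschitzWith.continuous (K := R.toNNReal) (LipschitzWith.of_dist_le_mul fun a b => ?_)
  rw [Real.coe_toNNReal R hR0, Real.dist_eq, dist_eq_norm, abs_sub_le_iff]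
  exact ⟨key a b, norm_sub_rev a b ▸ key b a⟩

/-- `T` contains a ball about `p`; test with its boundary point in direction `d`. As `0 ∈ T` is not
assumed, the norm may be negative, but the term `⟨p, d⟩` cancels around a closed line. -/
theorem IsConvexBody.exists_norm_le_finslerNorm (hT : IsConvexBody T) :
    ∃ p : EuclideanSpace ℝ (Fin n), ∃ r : ℝ, 0 < r ∧
      ∀ d, inner ℝ p d + r * ‖d‖ ≤ finslerNorm T d := by
  obtain ⟨p, hp⟩ := hT.interior_nonempty
  obtain ⟨r, hr, hball⟩ := Metric.nhds_basis_closedBall.mem_iff.1 (mem_interior_iff_mem_nhds.1 hp)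
  refine ⟨p, r, hr, fun d => ?_⟩
  rcases eq_or_ne d 0 with rfl | hd
  · simp [hT.finslerNorm_zero]
  have hd' : ‖d‖ ≠ 0 := norm_ne_zero_iff.2 hd
  have hmem : p + (r / ‖d‖) • d ∈ T := hball <| by
    rw [mem_closedBall_iff_norm, add_sub_cancel_left, norm_smul, norm_div, norm_norm,
      div_mul_cancel₀ _ hd', Real.norm_of_nonneg hr.le]
  have h := hT.inner_le_finslerNorm hmem d
  rw [inner_add_left, real_inner_smul_left, real_inner_self_eq_norm_sq] at h
  convert h using 2
  field_simp

/-! ### Closed polygonal lines -/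

theorem closedLength_succ (T : Set (EuclideanSpace ℝ (Fin n))) {m : ℕ}
    (q : Fin (m + 1) → EuclideanSpace ℝ (Fin n)) :
    closedLength T q = ∑ i : Fin m, finslerNorm T (q i.succ - q i.castSucc) +
      finslerNorm T (q 0 - q (Fin.last m)) := by
  rw [closedLength, Fin.sum_univ_castSucc]
  simp only [finRotate_apply, Fin.coeSucc_eq_succ, Fin.last_add_one]

theorem closedLength_cons (T : Set (EuclideanSpace ℝ (Fin n))) {m : ℕ}
    (a : EuclideanSpace ℝ (Fin n)) (q : Fin (m + 1) → EuclideanSpace ℝ (Fin n)) :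
    closedLength T (Fin.cons a q : Fin (m + 2) → EuclideanSpace ℝ (Fin n)) =
      finslerNorm T (q 0 - a) + ∑ i : Fin m, finslerNorm T (q i.succ - q i.castSucc) +
      finslerNorm T (a - q (Fin.last m)) := by
  rw [closedLength_succ, Fin.sum_univ_succ]
  simp [← Fin.succ_last]

theorem closedLength_comp_finRotate_pow (T : Set (EuclideanSpace ℝ (Fin n))) {m : ℕ}
    (q : Fin m → EuclideanSpace ℝ (Fin n)) (k : ℕ) :
    closedLength T (q ∘ (finRotate m ^ k : Equiv.Perm (Fin m))) = closedLength T q := by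
  unfold closedLength
  rw [← Equiv.sum_comp (finRotate m ^ k : Equiv.Perm (Fin m))
    (fun i => finslerNorm T (q (finRotate m i) - q i))]
  refine Finset.sum_congr rfl fun i _ => ?_
  simp only [Function.comp_apply, ← Equiv.Perm.mul_apply, ← pow_succ, ← pow_succ']

theorem finRotate_pow_apply_zero {m : ℕ} (i : Fin (m + 1)) :
    (finRotate (m + 1) ^ (i : ℕ) : Equiv.Perm (Fin (m + 1))) 0 = i := by
  induction i using Fin.induction with
  | zero => simp
  | succ j ih =>
    rw [Fin.val_castSucc] at ih
    rw [Fin.val_succ, pow_succ', Equiv.Perm.mul_apply, ih, finRotate_apply, Fin.coeSucc_eq_succ]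

theorem IsConvexBody.closedLength_le_cons (hT : IsConvexBody T) {m : ℕ}
    (a : EuclideanSpace ℝ (Fin n)) (q : Fin (m + 1) → EuclideanSpace ℝ (Fin n)) :
    closedLength T q ≤
      closedLength T (Fin.cons a q : Fin (m + 2) → EuclideanSpace ℝ (Fin n)) := by
  rw [closedLength_succ, closedLength_cons]
  have h := hT.finslerNorm_add_le (q 0 - a) (a - q (Fin.last m))
  rw [sub_add_sub_cancel] at h
  linarith

theorem IsConvexBody.closedLength_cons_self (hT : IsConvexBody T) {m : ℕ}
    (q : Fin (m + 1) → EuclideanSpace ℝ (Fin n)) :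
    closedLength T (Fin.cons (q 0) q : Fin (m + 2) → EuclideanSpace ℝ (Fin n)) =
      closedLength T q := by
  rw [closedLength_cons, closedLength_succ, sub_self, hT.finslerNorm_zero, zero_add]

theorem IsConvexBody.closedLength_smul (hT : IsConvexBody T) {m : ℕ} {c : ℝ} (hc : 0 < c)
    (q : Fin m → EuclideanSpace ℝ (Fin n)) :
    closedLength T (c • q) = c * closedLength T q := by
  simp only [closedLength, Finset.mul_sum, Pi.smul_apply, ← smul_sub, hT.finslerNorm_smul hc]

theorem closedLength_sub_const (T : Set (EuclideanSpace ℝ (Fin n))) {m : ℕ}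
    (q : Fin m → EuclideanSpace ℝ (Fin n)) (a : EuclideanSpace ℝ (Fin n)) :
    closedLength T (fun i => q i - a) = closedLength T q := by
  simp [closedLength]

theorem IsConvexBody.continuous_closedLength (hT : IsConvexBody T) {m : ℕ} :
    Continuous (closedLength T : (Fin m → EuclideanSpace ℝ (Fin n)) → ℝ) := by
  unfold closedLength
  have := hT.continuous_finslerNorm
  fun_prop

/-- Every edge is bounded by the total length, and `q i` is reached from `q 0` by at most `m` edges.
-/
theorem IsConvexBody.exists_norm_sub_le (hT : IsConvexBody T) (m : ℕ) :
    ∃ C : ℝ, ∀ (q : Fin (m + 1) → EuclideanSpace ℝ (Fin n)) (i : Fin (m + 1)),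
      ‖q i - q 0‖ ≤ C * closedLength T q := by
  obtain ⟨p, r, hr, h⟩ := hT.exists_norm_le_finslerNorm
  have hstep : ∀ (q : Fin (m + 1) → EuclideanSpace ℝ (Fin n)) (i : Fin (m + 1)),
      ‖q (finRotate _ i) - q i‖ ≤ closedLength T q / r := fun q i => by
    rw [le_div_iff₀' hr]
    calc r * ‖q (finRotate _ i) - q i‖ ≤ ∑ i, r * ‖q (finRotate _ i) - q i‖ :=
          Finset.single_le_sum (f := fun i => r * ‖q (finRotate _ i) - q i‖)
            (fun j _ => by positivity) (Finset.mem_univ i)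
      _ = ∑ i, (inner ℝ p (q (finRotate _ i) - q i) + r * ‖q (finRotate _ i) - q i‖) := by
          rw [Finset.sum_add_distrib, ← inner_sum, Finset.sum_sub_distrib,
            Equiv.sum_comp (finRotate (m + 1)) q, sub_self, inner_zero_right, zero_add]
      _ ≤ closedLength T q := Finset.sum_le_sum fun j _ => h _
  have hpath : ∀ (q : Fin (m + 1) → EuclideanSpace ℝ (Fin n)) (i : Fin (m + 1)),
      ‖q i - q 0‖ ≤ (i : ℕ) * (closedLength T q / r) := fun q i => by
    induction i using Fin.induction with
    | zero => simp
    | succ j ih =>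
      have h1 := hstep q j.castSucc
      rw [finRotate_apply, Fin.coeSucc_eq_succ] at h1
      have h2 := norm_sub_le_norm_sub_add_norm_sub (q j.succ) (q j.castSucc) (q 0)
      simp only [Fin.val_succ, Fin.val_castSucc, Nat.cast_add, Nat.cast_one] at ih ⊢
      linarith
  refine ⟨m / r, fun q i => (hpath q i).trans ?_⟩
  have h0 : 0 ≤ closedLength T q / r := (norm_nonneg _).trans (hstep q 0)
  have hi : ((i : ℕ) : ℝ) ≤ m := by exact_mod_cast Fin.is_le i
  calc ((i : ℕ) : ℝ) * (closedLength T q / r) ≤ m * (closedLength T q / r) := by gcongr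
    _ = _ := by ring

/-! ### Tuples that do not fit into the interior of a convex body -/

theorem mem_nonFitting {m : ℕ} {q : Fin m → EuclideanSpace ℝ (Fin n)} :
    q ∈ nonFitting m K ↔ ¬ ∃ t, ∀ i, q i - t ∈ interior K := by
  simp only [nonFitting, Set.mem_ofPred_eq, Set.range_subset_iff,
    Set.mem_vadd_set_iff_neg_vadd_mem, vadd_eq_add, neg_add_eq_sub]

theorem isClosed_nonFitting (m : ℕ) (K : Set (EuclideanSpace ℝ (Fin n))) :
    IsClosed (nonFitting m K) := by
  have : (nonFitting m K)ᶜ =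
      ⋃ t : EuclideanSpace ℝ (Fin n), ⋂ i : Fin m, {q | q i - t ∈ interior K} := by
    ext q
    simp [mem_nonFitting]
  rw [← isOpen_compl_iff, this]
  refine isOpen_iUnion fun t => isOpen_iInter_of_finite fun i => ?_
  exact isOpen_interior.preimage (by fun_prop)

theorem sub_const_mem_nonFitting {m : ℕ} {q : Fin m → EuclideanSpace ℝ (Fin n)}
    (hq : q ∈ nonFitting m K) (a : EuclideanSpace ℝ (Fin n)) :
    (fun i => q i - a) ∈ nonFitting m K := by
  rw [mem_nonFitting] at hq ⊢
  rintro ⟨t, ht⟩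
  exact hq ⟨a + t, fun i => by simpa only [sub_sub] using ht i⟩

theorem cons_mem_nonFitting {m : ℕ} {q : Fin m → EuclideanSpace ℝ (Fin n)}
    (hq : q ∈ nonFitting m K) (a : EuclideanSpace ℝ (Fin n)) :
    (Fin.cons a q : Fin (m + 1) → EuclideanSpace ℝ (Fin n)) ∈ nonFitting (m + 1) K := by
  rw [mem_nonFitting] at hq ⊢
  rintro ⟨t, ht⟩
  exact hq ⟨t, fun i => by simpa using ht i.succ⟩

/-- A translate fitting `c • q` into `K'` would, divided by `c`, fit `q` into `K`. -/
theorem smul_mem_nonFitting {K' : Set (EuclideanSpace ℝ (Fin n))} {m : ℕ} {c : ℝ} (hc : 0 < c)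
    {s : EuclideanSpace ℝ (Fin n)} (hsub : K' ⊆ s +ᵥ c • K)
    {q : Fin m → EuclideanSpace ℝ (Fin n)} (hq : q ∈ nonFitting m K) :
    c • q ∈ nonFitting m K' := by
  rw [mem_nonFitting] at hq ⊢
  rintro ⟨t, ht⟩
  refine hq ⟨c⁻¹ • (t + s), fun i => ?_⟩
  have h := interior_mono hsub (ht i)
  rw [interior_vadd, interior_smul₀ hc.ne', Set.mem_vadd_set_iff_neg_vadd_mem,
    Set.mem_smul_set_iff_inv_smul_mem₀ hc.ne'] at h
  convert h using 1
  simp only [Pi.smul_apply, vadd_eq_add, smul_add, smul_sub, smul_neg, inv_smul_smul₀ hc.ne']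
  abel

theorem exists_mem_nonFitting (hn : 1 ≤ n) (hK : IsCompact K) {m : ℕ} (hm : 2 ≤ m) :
    ∃ q, q ∈ nonFitting m K := by
  have : Nonempty (Fin n) := ⟨⟨0, hn⟩⟩
  obtain ⟨R, hR⟩ := hK.isBounded.exists_norm_le
  -- Two points of `K` are at distance at most `2 * R`, so `0` and `w` never fit together.
  obtain ⟨w, hw⟩ := NormedSpace.exists_lt_norm ℝ (EuclideanSpace ℝ (Fin n)) (2 * R)
  refine ⟨fun i => if i = ⟨0, by omega⟩ then w else 0, ?_⟩
  rw [mem_nonFitting]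
  rintro ⟨t, ht⟩
  have h0 := hR _ (interior_subset (ht ⟨0, by omega⟩))
  have h1 := hR _ (interior_subset (ht ⟨1, by omega⟩))
  simp only [if_true] at h0
  rw [if_neg (by simp)] at h1
  have h2 := norm_sub_le (w - t) (0 - t)
  rw [sub_sub_sub_cancel_right, sub_zero] at h2
  linarith

/-- Helly for the sets of admissible translations: any `n + 1` of them omit some index. -/
theorem exists_removable_vertex (hK : IsConvexBody K) {m : ℕ} (hm : n + 1 ≤ m)
    {q : Fin (m + 1) → EuclideanSpace ℝ (Fin n)} (hq : q ∈ nonFitting (m + 1) K) :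
    ∃ i : Fin (m + 1), ¬ ∃ t, ∀ j, j ≠ i → q j - t ∈ interior K := by
  by_contra! hall
  rw [mem_nonFitting] at hq
  have hset : ∀ j : Fin (m + 1), {t | q j - t ∈ interior K} =
      (fun t => q j - t) ⁻¹' interior K := fun j => rfl
  have hne : (⋂ j ∈ (Finset.univ : Finset (Fin (m + 1))),
      {t | q j - t ∈ interior K}).Nonempty := by
    refine Convex.helly_theorem (𝕜 := ℝ) ?_ ?_ ?_
    · simp; omega
    · intro j _ x hx y hy a b ha hb hab
      have h := hK.convex.interior hx hy ha hb hab
      have he : a • (q j - x) + b • (q j - y) = q j - (a • x + b • y) := by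
        nth_rw 3 [← one_smul ℝ (q j)]
        rw [← hab]
        module
      rwa [he] at h
    · intro I _ hI
      rw [finrank_euclideanSpace_fin] at hI
      obtain ⟨i, hi⟩ : ∃ i, i ∉ I := by
        by_contra! hcon
        rw [Finset.eq_univ_of_forall hcon] at hI
        simp at hI
        omega
      obtain ⟨t, ht⟩ := hall i
      refine ⟨t, ?_⟩
      simp only [Set.mem_iInter, Set.mem_ofPred_eq]
      exact fun j hj => ht j (fun h => hi (h ▸ hj))
  obtain ⟨t, ht⟩ := hne
  exact hq ⟨t, fun j => by simpa using Set.mem_iInter₂.1 ht j (Finset.mem_univ j)⟩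

theorem exists_nonFitting_closedLength_le_pred (hK : IsConvexBody K) (hT : IsConvexBody T) {m : ℕ}
    (hm : n ≤ m) {q : Fin (m + 2) → EuclideanSpace ℝ (Fin n)} (hq : q ∈ nonFitting (m + 2) K) :
    ∃ q' ∈ nonFitting (m + 1) K, closedLength T q' ≤ closedLength T q := by
  obtain ⟨i, hi⟩ := exists_removable_vertex hK (by omega) hq
  -- Rotation moves the removable vertex to the front, where `Fin.tail` deletes it.
  set σ : Equiv.Perm (Fin (m + 2)) := finRotate (m + 2) ^ (i : ℕ)
  have hσ : σ 0 = i := finRotate_pow_apply_zero i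
  refine ⟨Fin.tail (q ∘ σ), ?_, ?_⟩
  · rw [mem_nonFitting]
    rintro ⟨t, ht⟩
    refine hi ⟨t, fun j hj => ?_⟩
    have hne : σ.symm j ≠ 0 := fun h => hj (by rw [← hσ, ← h, Equiv.apply_symm_apply])
    obtain ⟨k, hk⟩ := Fin.exists_succ_eq.2 hne
    have := ht k
    rwa [Fin.tail, hk, Function.comp_apply, Equiv.apply_symm_apply] at this
  · have h := hT.closedLength_le_cons ((q ∘ σ) 0) (Fin.tail (q ∘ σ))
    rwa [Fin.cons_self_tail, closedLength_comp_finRotate_pow] at h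

theorem exists_nonFitting_closedLength_le (hK : IsConvexBody K) (hT : IsConvexBody T) {m : ℕ}
    (q : Fin (m + 1) → EuclideanSpace ℝ (Fin n)) (hq : q ∈ nonFitting (m + 1) K) :
    ∃ q' ∈ nonFitting (n + 1) K, closedLength T q' ≤ closedLength T q := by
  rcases le_total n m with h | h
  · induction m, h using Nat.le_induction with
    | base => exact ⟨q, hq, le_rfl⟩
    | succ m hm ih =>
      obtain ⟨q', hq', hle⟩ := exists_nonFitting_closedLength_le_pred hK hT hm hq
      obtain ⟨q'', hq'', hle'⟩ := ih q' hq'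
      exact ⟨q'', hq'', hle'.trans hle⟩
  · induction h using Nat.decreasingInduction with
    | self => exact ⟨q, hq, le_rfl⟩
    | of_succ m hm ih =>
      -- Too few vertices: repeating the first one costs no length.
      obtain ⟨q', hq', hle⟩ := ih _ (cons_mem_nonFitting hq (q 0))
      exact ⟨q', hq', hle.trans_eq (hT.closedLength_cons_self q)⟩

/-! ### Existence of shortest closed polygonal lines -/

theorem exists_forall_closedLength_le (hn : 1 ≤ n) (hK : IsConvexBody K) (hT : IsConvexBody T) :
    ∃ q ∈ nonFitting (n + 1) K, ∀ q' ∈ nonFitting (n + 1) K,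
      closedLength T q ≤ closedLength T q' := by
  obtain ⟨p, hp⟩ := exists_mem_nonFitting hn hK.isCompact (m := n + 1) (by omega)
  obtain ⟨C, hC⟩ := hT.exists_norm_sub_le n
  -- Translation normalises `q 0 = 0`; the length cap then bounds all the vertices.
  set S : Set (Fin (n + 1) → EuclideanSpace ℝ (Fin n)) :=
    nonFitting (n + 1) K ∩ {q | q 0 = 0} ∩ {q | closedLength T q ≤ closedLength T p}
  have hSc : IsClosed S :=
    ((isClosed_nonFitting _ K).inter (isClosed_eq (by fun_prop) continuous_const)).inter
      (isClosed_le hT.continuous_closedLength continuous_const)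
  have hSb : Bornology.IsBounded S := by
    refine (Metric.isBounded_closedBall (x := 0) (r := |C| * closedLength T p)).subset ?_
    rintro q ⟨⟨-, h0⟩, hle⟩
    rw [Set.mem_ofPred_eq] at h0 hle
    have hb : ∀ i, ‖q i‖ ≤ |C| * closedLength T p := fun i => by
      have hnn : 0 ≤ closedLength T q := by
        obtain ⟨c, r, hr, h⟩ := hT.exists_norm_le_finslerNorm
        calc (0 : ℝ) = ∑ i, inner ℝ c (q (finRotate _ i) - q i) := by
              rw [← inner_sum, Finset.sum_sub_distrib, Equiv.sum_comp (finRotate (n + 1)) q,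
                sub_self, inner_zero_right]
          _ ≤ closedLength T q := Finset.sum_le_sum fun i _ =>
              (le_add_of_nonneg_right (by positivity)).trans (h _)
      have h := hC q i
      rw [h0, sub_zero] at h
      calc ‖q i‖ ≤ C * closedLength T q := h
        _ ≤ |C| * closedLength T q := mul_le_mul_of_nonneg_right (le_abs_self C) hnn
        _ ≤ _ := mul_le_mul_of_nonneg_left hle (abs_nonneg C)
    rw [mem_closedBall_zero_iff]
    exact (pi_norm_le_iff_of_nonneg ((norm_nonneg _).trans (hb 0))).2 hb
  have hSn : S.Nonempty :=
    ⟨fun i => p i - p 0, ⟨sub_const_mem_nonFitting hp _, by simp⟩,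
      (closedLength_sub_const T p (p 0)).le⟩
  obtain ⟨q, hq, hmin⟩ := (Metric.isCompact_of_isClosed_isBounded hSc hSb).exists_isMinOn hSn
    hT.continuous_closedLength.continuousOn
  refine ⟨q, hq.1.1, fun q' hq' => ?_⟩
  rcases le_total (closedLength T q') (closedLength T p) with h | h
  · rw [← closedLength_sub_const T q' (q' 0)] at h ⊢
    exact hmin ⟨⟨sub_const_mem_nonFitting hq' _, by simp⟩, h⟩
  · exact hq.2.trans h

theorem exists_isLeast_lengthSet (hn : 1 ≤ n) (hK : IsConvexBody K) (hT : IsConvexBody T) :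
    ∃ q ∈ nonFitting (n + 1) K, IsLeast (lengthSet T K) (closedLength T q) := by
  obtain ⟨q, hq, hmin⟩ := exists_forall_closedLength_le hn hK hT
  refine ⟨q, hq, ⟨n + 1, by omega, q, hq, rfl⟩, ?_⟩
  rintro _ ⟨m, hm, q', hq', rfl⟩
  obtain ⟨m, rfl⟩ : ∃ k, m = k + 1 := ⟨m - 1, by omega⟩
  obtain ⟨q'', hq'', hle⟩ := exists_nonFitting_closedLength_le hK hT q' hq'
  exact (hmin q'' hq'').trans hle

/-- The minimum `ξ_T(K)` is attained, by a closed polygonal line with `n + 1` vertices. -/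
theorem exists_closedLength_eq_xi (hn : 1 ≤ n) (hK : IsConvexBody K) (hT : IsConvexBody T) :
    ∃ q ∈ nonFitting (n + 1) K, closedLength T q = xi T K := by
  obtain ⟨q, hq, hmin⟩ := exists_isLeast_lengthSet hn hK hT
  exact ⟨q, hq, hmin.csInf_eq.symm⟩

theorem isLeast_xi (hn : 1 ≤ n) (hK : IsConvexBody K) (hT : IsConvexBody T) :
    IsLeast (lengthSet T K) (xi T K) := by
  obtain ⟨q, -, hmin⟩ := exists_isLeast_lengthSet hn hK hT
  rwa [show xi T K = closedLength T q from hmin.csInf_eq]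

/-! ### The difference body -/

theorem IsConvexBody.sub (hK : IsConvexBody K) : IsConvexBody (K - K) where
  convex := hK.convex.sub hK.convex
  isCompact := sub_eq_add_neg K K ▸ hK.isCompact.add hK.isCompact.neg
  interior_nonempty :=
    (hK.interior_nonempty.sub hK.nonempty).mono subset_interior_sub_left

theorem IsConvexBody.sum_mem_smul (hK : IsConvexBody K) {s : Finset (EuclideanSpace ℝ (Fin n))}
    (hs : s.Nonempty) (hsK : ∀ x ∈ s, x ∈ K) : ∑ x ∈ s, x ∈ (s.card : ℝ) • K := by
  have hc : (s.card : ℝ) ≠ 0 := by exact_mod_cast hs.card_pos.ne'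
  rw [Set.mem_smul_set_iff_inv_smul_mem₀ hc, Finset.smul_sum]
  refine hK.convex.sum_mem (fun _ _ => by positivity) ?_ hsK
  rw [Finset.sum_const, nsmul_eq_mul, mul_inv_cancel₀ hc]

/-- Minkowski's bound on the asymmetry of a convex body: `-K` is contained in a translate of
`n K`. -/
theorem IsConvexBody.exists_sub_mem_smul (hn : 1 ≤ n) (hK : IsConvexBody K) :
    ∃ t, ∀ x ∈ K, t - x ∈ (n : ℝ) • K := by
  classical
  have : Nonempty (Fin n) := ⟨⟨0, hn⟩⟩
  -- Helly needs at least `n + 1` index points.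
  have hinf : Infinite K := by
    obtain ⟨x, hx⟩ := hK.interior_nonempty
    exact (infinite_of_mem_nhds x (mem_interior_iff_mem_nhds.1 hx)).to_subtype
  obtain ⟨t, ht⟩ : (⋂ x : K, ((x : EuclideanSpace ℝ (Fin n)) +ᵥ (n : ℝ) • K)).Nonempty := by
    refine Convex.helly_theorem_compact (𝕜 := ℝ) (by simp)
      (fun x => (hK.convex.smul _).vadd _) (fun x => (hK.isCompact.smul _).vadd _) ?_
    intro I hI
    rw [finrank_euclideanSpace_fin] at hI
    -- Subtracting one of the `n + 1` points leaves a sum of `n` points of `K`.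
    refine ⟨∑ x ∈ I, (x : EuclideanSpace ℝ (Fin n)), Set.mem_iInter₂.2 fun x hx => ?_⟩
    rw [Set.mem_vadd_set_iff_neg_vadd_mem, vadd_eq_add, neg_add_eq_sub,
      ← Finset.add_sum_erase I _ hx, add_sub_cancel_left]
    have hcard : ((I.erase x).map (Function.Embedding.subtype _)).card = n := by
      rw [Finset.card_map, Finset.card_erase_of_mem hx, hI, Nat.add_sub_cancel]
    have h := hK.sum_mem_smul (s := (I.erase x).map (Function.Embedding.subtype _))
      (Finset.card_pos.1 (by omega)) (by
        intro y hy
        obtain ⟨z, -, rfl⟩ := Finset.mem_map.1 hy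
        exact z.2)
    rwa [hcard, Finset.sum_map] at h
  refine ⟨t, fun x hx => ?_⟩
  have h := Set.mem_iInter.1 ht ⟨x, hx⟩
  rwa [Set.mem_vadd_set_iff_neg_vadd_mem, vadd_eq_add, neg_add_eq_sub] at h

theorem IsConvexBody.exists_sub_subset (hn : 1 ≤ n) (hK : IsConvexBody K) :
    ∃ s : EuclideanSpace ℝ (Fin n), K - K ⊆ s +ᵥ ((n : ℝ) + 1) • K := by
  obtain ⟨t, ht⟩ := hK.exists_sub_mem_smul hn
  refine ⟨-t, ?_⟩
  rintro _ ⟨a, ha, b, hb, rfl⟩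
  -- By convexity `(n + 1) K = K + n K`, and `a - b + t = a + (t - b)`.
  rw [Set.mem_vadd_set_iff_neg_vadd_mem, neg_neg, vadd_eq_add, add_comm (n : ℝ),
    hK.convex.add_smul zero_le_one (Nat.cast_nonneg n), one_smul]
  exact ⟨a, ha, t - b, ht b hb, by simp only; abel⟩

theorem xi_sub_le (hn : 1 ≤ n) (hK : IsConvexBody K) (hT : IsConvexBody T) :
    xi T (K - K) ≤ ((n : ℝ) + 1) * xi T K := by
  obtain ⟨q, hq, hlen⟩ := exists_closedLength_eq_xi hn hK hT
  obtain ⟨s, hs⟩ := hK.exists_sub_subset hn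
  have hpos : (0 : ℝ) < n + 1 := by positivity
  rw [← hlen, ← hT.closedLength_smul hpos]
  exact (isLeast_xi hn hK.sub hT).2
    ⟨n + 1, by omega, _, smul_mem_nonFitting hpos hs hq, rfl⟩

end FinslerBilliard

namespace FinslerBilliard

/-! ### Polar bodies -/

theorem IsConvexBody.polarBody {n : ℕ} {K : Set (EuclideanSpace ℝ (Fin n))}
    (hK : IsConvexBody K) (h0 : 0 ∈ interior K) : IsConvexBody (polarBody K) where
  convex := by
    intro x hx y hy a b ha hb hab q hq
    rw [inner_add_left, real_inner_smul_left, real_inner_smul_left]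
    nlinarith [mul_le_mul_of_nonneg_left (hx q hq) ha, mul_le_mul_of_nonneg_left (hy q hq) hb]
  isCompact := by
    refine Metric.isCompact_of_isClosed_isBounded ?_ ?_
    · have : FinslerBilliard.polarBody K = ⋂ q ∈ K, {p | inner ℝ p q ≤ 1} := by
        ext p
        simp [FinslerBilliard.polarBody]
      rw [this]
      exact isClosed_biInter fun q _ => isClosed_le (by fun_prop) continuous_const
    · obtain ⟨r, hr, hball⟩ :=
        Metric.nhds_basis_closedBall.mem_iff.1 (mem_interior_iff_mem_nhds.1 h0)
      refine (Metric.isBounded_closedBall (x := 0) (r := 1 / r)).subset fun p hp => ?_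
      rw [mem_closedBall_zero_iff, le_div_iff₀' hr]
      rcases eq_or_ne p 0 with rfl | hp0
      · simp
      have hn : ‖p‖ ≠ 0 := norm_ne_zero_iff.2 hp0
      have h := hp ((r / ‖p‖) • p) <| hball <| by
        rw [mem_closedBall_zero_iff, norm_smul, norm_div, norm_norm, div_mul_cancel₀ _ hn,
          Real.norm_of_nonneg hr.le]
      rw [real_inner_smul_right, real_inner_self_eq_norm_sq] at h
      have he : r / ‖p‖ * ‖p‖ ^ 2 = r * ‖p‖ := by field_simp
      rwa [he] at h
  interior_nonempty := by
    obtain ⟨R, hR⟩ := hK.isCompact.isBounded.exists_norm_le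
    have hR0 : 0 ≤ R := (norm_nonneg _).trans (hR 0 (interior_subset h0))
    refine ⟨0, mem_interior_iff_mem_nhds.2 (Filter.mem_of_superset
      (Metric.ball_mem_nhds 0 (show 0 < 1 / (R + 1) by positivity)) fun p hp q hq => ?_)⟩
    rw [mem_ball_zero_iff, lt_div_iff₀ (by positivity)] at hp
    calc inner ℝ p q ≤ ‖p‖ * ‖q‖ := real_inner_le_norm p q
      _ ≤ ‖p‖ * (R + 1) := by
        gcongr
        linarith [hR q hq]
      _ ≤ 1 := hp.le

/-! ### Centred triangles in the plane -/

/-- `v` lists the vertices of a triangle in the plane with centroid at the origin, and `u` the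
outer normals of the sides opposite to them, so that the triangle is
`{x | ∀ i, ⟨u i, x⟩ ≤ 1}`. -/
structure IsCentredTriangle (v u : Fin 3 → EuclideanSpace ℝ (Fin 2)) : Prop where
  sum_vertices : v 0 + v 1 + v 2 = 0
  sum_normals : u 0 + u 1 + u 2 = 0
  inner_self : ∀ i, inner ℝ (u i) (v i) = (-2 : ℝ)
  inner_of_ne : ∀ i j, i ≠ j → inner ℝ (u i) (v j) = (1 : ℝ)
  ext_inner : ∀ x, (∀ i, inner ℝ (u i) x = (0 : ℝ)) → x = 0

namespace IsCentredTriangle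

variable {v u : Fin 3 → EuclideanSpace ℝ (Fin 2)}

theorem sum_inner (h : IsCentredTriangle v u) (x : EuclideanSpace ℝ (Fin 2)) :
    inner ℝ (u 0) x + inner ℝ (u 1) x + inner ℝ (u 2) x = (0 : ℝ) := by
  rw [← inner_add_left, ← inner_add_left, h.sum_normals, inner_zero_left]

/-- The matrix `⟨u i, v j⟩` is all ones minus three times the identity, so it acts as `-3` on
sum-zero vectors. -/
theorem exists_inner_eq (h : IsCentredTriangle v u) (t : Fin 3 → ℝ) (ht : t 0 + t 1 + t 2 = 0) :
    ∃ x, ∀ i, inner ℝ (u i) x = t i := by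
  refine ⟨(-t 0 / 3) • v 0 + (-t 1 / 3) • v 1 + (-t 2 / 3) • v 2, fun i => ?_⟩
  simp only [inner_add_right, real_inner_smul_right]
  fin_cases i
  · simp [h.inner_self, h.inner_of_ne]; linarith
  · simp [h.inner_self, h.inner_of_ne]; linarith
  · simp [h.inner_self, h.inner_of_ne]; linarith

/-- The coefficients are the barycentric coordinates. -/
theorem eq_sum_smul (h : IsCentredTriangle v u) (x : EuclideanSpace ℝ (Fin 2)) :
    x = ∑ i, ((1 - inner ℝ (u i) x) / 3) • v i := by
  have hs := h.sum_inner x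
  refine sub_eq_zero.1 (h.ext_inner _ fun i => ?_)
  simp only [Fin.sum_univ_three, inner_sub_right, inner_add_right, real_inner_smul_right]
  fin_cases i
  · simp [h.inner_self, h.inner_of_ne]; linarith
  · simp [h.inner_self, h.inner_of_ne]; linarith
  · simp [h.inner_self, h.inner_of_ne]; linarith

theorem mem_convexHull_iff (h : IsCentredTriangle v u) {x : EuclideanSpace ℝ (Fin 2)} :
    x ∈ convexHull ℝ (Set.range v) ↔ ∀ i, inner ℝ (u i) x ≤ (1 : ℝ) := by
  constructor
  · intro hx i
    refine convexHull_min (t := {x | inner ℝ (u i) x ≤ (1 : ℝ)}) ?_ ?_ hx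
    · rintro _ ⟨j, rfl⟩
      rw [Set.mem_ofPred_eq]
      rcases eq_or_ne i j with rfl | hij
      · rw [h.inner_self]; norm_num
      · rw [h.inner_of_ne i j hij]
    · exact convex_halfSpace_le (innerₛₗ ℝ (u i)).isLinear 1
  · intro hx
    rw [h.eq_sum_smul x]
    refine (convex_convexHull ℝ _).sum_mem (fun i _ => ?_) ?_
      fun i _ => subset_convexHull ℝ _ ⟨i, rfl⟩
    · linarith [hx i]
    · have := h.sum_inner x
      rw [Fin.sum_univ_three]
      linarith

theorem zero_mem_interior (h : IsCentredTriangle v u) :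
    0 ∈ interior (convexHull ℝ (Set.range v)) := by
  have hopen : IsOpen (⋂ i, {x | inner ℝ (u i) x < (1 : ℝ)}) :=
    isOpen_iInter_of_finite fun i => isOpen_lt (by fun_prop) continuous_const
  refine interior_maximal (fun x hx => ?_) hopen (by simp)
  exact h.mem_convexHull_iff.2 fun i => (Set.mem_iInter.1 hx i).le

theorem isConvexBody (h : IsCentredTriangle v u) :
    IsConvexBody (convexHull ℝ (Set.range v)) where
  convex := convex_convexHull ℝ _
  isCompact := (Set.finite_range v).isCompact_convexHull ℝ
  interior_nonempty := ⟨0, h.zero_mem_interior⟩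

theorem isConvexBody_polarBody (h : IsCentredTriangle v u) :
    IsConvexBody (polarBody (convexHull ℝ (Set.range v))) :=
  h.isConvexBody.polarBody h.zero_mem_interior

/-- Moving along `-v i` increases `⟨u i, ·⟩`, so an interior point cannot attain the bound. -/
theorem inner_lt_one (h : IsCentredTriangle v u) {x : EuclideanSpace ℝ (Fin 2)}
    (hx : x ∈ interior (convexHull ℝ (Set.range v))) (i : Fin 3) :
    inner ℝ (u i) x < (1 : ℝ) := by
  have ht : Filter.Tendsto (fun s : ℝ => x - s • v i) (nhdsWithin 0 (Set.Ioi 0)) (nhds x) := by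
    refine tendsto_nhdsWithin_of_tendsto_nhds (Continuous.tendsto' (by fun_prop) _ _ (by simp))
  obtain ⟨s, hs, hs0⟩ :=
    ((ht.eventually (mem_interior_iff_mem_nhds.1 hx)).and self_mem_nhdsWithin).exists
  have h1 := h.mem_convexHull_iff.1 hs i
  rw [inner_sub_right, real_inner_smul_right, h.inner_self] at h1
  linarith

theorem mem_interior_sub (h : IsCentredTriangle v u) {x : EuclideanSpace ℝ (Fin 2)}
    (hx : ∀ i, |inner ℝ (u i) x| < (3 : ℝ)) :
    x ∈ interior (convexHull ℝ (Set.range v) - convexHull ℝ (Set.range v)) := by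
  have hopen : IsOpen (⋂ i, {x | |inner ℝ (u i) x| < (3 : ℝ)}) :=
    isOpen_iInter_of_finite fun i => isOpen_lt (by fun_prop) continuous_const
  refine interior_maximal (fun x hx => ?_) hopen (Set.mem_iInter.2 hx)
  have hx' : ∀ i, |inner ℝ (u i) x| < (3 : ℝ) := fun i => Set.mem_iInter.1 hx i
  have hs := h.sum_inner x
  -- Both `b` and `x + b` lie in the triangle iff the coordinates of `b` are at most `m`. A sum-zero
  -- choice exists once `∑ m i ≥ 0`: lower each `m i` by the mean.
  set m : Fin 3 → ℝ := fun i => min 1 (1 - inner ℝ (u i) x)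
  have hm1 : ∀ i, m i ≤ 1 := fun i => min_le_left _ _
  have hm2 : ∀ i, m i ≤ 1 - inner ℝ (u i) x := fun i => min_le_right _ _
  have hm0 : 0 ≤ m 0 + m 1 + m 2 := by
    have h0 := abs_lt.1 (hx' 0)
    have h1 := abs_lt.1 (hx' 1)
    have h2 := abs_lt.1 (hx' 2)
    simp only [m]
    rcases min_choice 1 (1 - inner ℝ (u 0) x) with e0 | e0 <;>
    rcases min_choice 1 (1 - inner ℝ (u 1) x) with e1 | e1 <;>
    rcases min_choice 1 (1 - inner ℝ (u 2) x) with e2 | e2 <;>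
    rw [e0, e1, e2] <;> linarith
  obtain ⟨b, hb⟩ := h.exists_inner_eq (fun i => m i - (m 0 + m 1 + m 2) / 3) (by ring)
  refine ⟨x + b, h.mem_convexHull_iff.2 fun i => ?_, b, h.mem_convexHull_iff.2 fun i => ?_,
    add_sub_cancel_right x b⟩
  · rw [inner_add_right, hb]
    linarith [hm2 i]
  · rw [hb]
    linarith [hm1 i]

theorem normal_mem_polarBody (h : IsCentredTriangle v u) (i : Fin 3) :
    u i ∈ polarBody (convexHull ℝ (Set.range v)) :=
  fun _ hq => h.mem_convexHull_iff.1 hq i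

theorem xi_le (h : IsCentredTriangle v u) :
    xi (polarBody (convexHull ℝ (Set.range v))) (convexHull ℝ (Set.range v)) ≤ 3 := by
  set K := convexHull ℝ (Set.range v)
  have hN : ∀ i, finslerNorm (polarBody K) (v i) ≤ 1 := fun i =>
    h.isConvexBody_polarBody.finslerNorm_le fun p hp => hp _ (subset_convexHull ℝ _ ⟨i, rfl⟩)
  -- Each vertex is tested against a different side: `⟨u i, q i⟩` is 0, 1, 2, with sum 3, unchanged
  -- by translation, whereas fitting would make it less than 3.
  have hmem : ![0, v 0, v 0 + v 1] ∈ nonFitting 3 K := by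
    rw [mem_nonFitting]
    rintro ⟨t, ht⟩
    have h0 := h.inner_lt_one (ht 0) 0
    have h1 := h.inner_lt_one (ht 1) 1
    have h2 := h.inner_lt_one (ht 2) 2
    have hs := h.sum_inner t
    simp [inner_sub_right, inner_add_right, h.inner_of_ne] at h0 h1 h2
    linarith
  have hlen : closedLength (polarBody K) ![0, v 0, v 0 + v 1] ≤ 3 := by
    have h2 : 0 - (v 0 + v 1) = v 2 := by
      rw [zero_sub, neg_eq_iff_add_eq_zero]
      exact h.sum_vertices
    rw [closedLength_succ, Fin.sum_univ_two]
    simp only [Fin.succ_zero_eq_one, Fin.castSucc_zero, Matrix.cons_val_zero, Matrix.cons_val_one,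
      Fin.succ_one_eq_two, Fin.castSucc_one, Matrix.cons_val, sub_zero, add_sub_cancel_left,
      Fin.reduceLast, h2]
    linarith [hN 0, hN 1, hN 2]
  exact ((isLeast_xi (by norm_num) h.isConvexBody h.isConvexBody_polarBody).2
    ⟨3, by norm_num, _, hmem, rfl⟩).trans hlen

end IsCentredTriangle

/-- Interpolate between `lo` and `hi` at the parameter where the sum vanishes. -/
theorem exists_sum_eq_zero_of_lt {lo hi : Fin 3 → ℝ} (hlt : ∀ i, lo i < hi i)
    (hlo : lo 0 + lo 1 + lo 2 < 0) (hhi : 0 < hi 0 + hi 1 + hi 2) :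
    ∃ t : Fin 3 → ℝ, t 0 + t 1 + t 2 = 0 ∧ ∀ i, lo i < t i ∧ t i < hi i := by
  set A := lo 0 + lo 1 + lo 2 with hA
  set B := hi 0 + hi 1 + hi 2 with hB
  have hBA : 0 < B - A := by linarith
  have hs0 : 0 < -A / (B - A) := div_pos (by linarith) hBA
  have hs1 : -A / (B - A) < 1 := (div_lt_one hBA).2 (by linarith)
  have hsum : -A / (B - A) * (B - A) = -A := div_mul_cancel₀ _ hBA.ne'
  refine ⟨fun i => lo i + -A / (B - A) * (hi i - lo i), ?_, fun i => ⟨?_, ?_⟩⟩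
  · linear_combination hsum - hA + (-A / (B - A)) * (hA - hB)
  · have := mul_pos hs0 (sub_pos.2 (hlt i))
    linarith
  · nlinarith [hlt i]

/-- A closed triangular path with short total length in the norm `max_i y_i` on the plane
`∑ y_i = 0` fits into a translate of the open hexagon `|y_i| < 3`. -/
theorem exists_translate_abs_lt {a : Fin 3 → Fin 3 → ℝ} {N : Fin 3 → ℝ}
    (ha : ∀ k, a 0 k + a 1 k + a 2 k = 0)
    (h01 : ∀ i, a i 1 - a i 0 ≤ N 0) (h12 : ∀ i, a i 2 - a i 1 ≤ N 1)
    (h20 : ∀ i, a i 0 - a i 2 ≤ N 2) (hN : N 0 + N 1 + N 2 < 9) :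
    ∃ t : Fin 3 → ℝ, t 0 + t 1 + t 2 = 0 ∧ ∀ i k, |a i k + t i| < 3 := by
  have a0 := ha 0
  have a1 := ha 1
  have a2 := ha 2
  have b00 := h01 0
  have b01 := h01 1
  have b02 := h01 2
  have b10 := h12 0
  have b11 := h12 1
  have b12 := h12 2
  have b20 := h20 0
  have b21 := h20 1
  have b22 := h20 2
  -- For distinct indices, compare with each vertex in turn, where the coordinates sum to zero, and
  -- average the three bounds: the result is `∑ N`.
  have hmax : ∀ j k l : Fin 3, a 0 j + a 1 k + a 2 l < 9 := by
    simp only [Fin.forall_fin_succ, Fin.forall_fin_zero, Fin.succ_zero_eq_one,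
      Fin.succ_one_eq_two, and_true]
    refine ⟨⟨⟨?_, ?_, ?_⟩, ⟨?_, ?_, ?_⟩, ?_, ?_, ?_⟩, ⟨⟨?_, ?_, ?_⟩, ⟨?_, ?_, ?_⟩, ?_, ?_, ?_⟩,
      ⟨?_, ?_, ?_⟩, ⟨?_, ?_, ?_⟩, ?_, ?_, ?_⟩ <;> linarith
  have hmin : ∀ j k l : Fin 3, -9 < a 0 j + a 1 k + a 2 l := by
    simp only [Fin.forall_fin_succ, Fin.forall_fin_zero, Fin.succ_zero_eq_one,
      Fin.succ_one_eq_two, and_true]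
    refine ⟨⟨⟨?_, ?_, ?_⟩, ⟨?_, ?_, ?_⟩, ?_, ?_, ?_⟩, ⟨⟨?_, ?_, ?_⟩, ⟨?_, ?_, ?_⟩, ?_, ?_, ?_⟩,
      ⟨?_, ?_, ?_⟩, ⟨?_, ?_, ?_⟩, ?_, ?_, ?_⟩ <;> linarith
  -- A coordinate rises by at most `N` along an edge and falls by at most `2 N`, being minus the sum
  -- of the others. A width `w` thus costs `w + w / 2`, which is below 9.
  have hwidth : ∀ i k l : Fin 3, a i k - a i l < 6 := by
    simp only [Fin.forall_fin_succ, Fin.forall_fin_zero, Fin.succ_zero_eq_one,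
      Fin.succ_one_eq_two, and_true]
    refine ⟨⟨⟨?_, ?_, ?_⟩, ⟨?_, ?_, ?_⟩, ?_, ?_, ?_⟩, ⟨⟨?_, ?_, ?_⟩, ⟨?_, ?_, ?_⟩, ?_, ?_, ?_⟩,
      ⟨?_, ?_, ?_⟩, ⟨?_, ?_, ?_⟩, ?_, ?_, ?_⟩ <;> linarith
  choose M hM using fun i => Finite.exists_max (a i)
  choose m hm using fun i => Finite.exists_min (a i)
  -- `t i` must lie strictly between these bounds; width and sum estimates make a sum-zero choice
  -- possible.
  obtain ⟨t, ht0, ht⟩ := exists_sum_eq_zero_of_lt (lo := fun i => -3 - a i (m i))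
    (hi := fun i => 3 - a i (M i)) (fun i => by linarith [hwidth i (M i) (m i)])
    (by linarith [hmin (m 0) (m 1) (m 2)]) (by linarith [hmax (M 0) (M 1) (M 2)])
  refine ⟨t, ht0, fun i k => abs_lt.2 ⟨?_, ?_⟩⟩
  · linarith [(ht i).1, hm i k]
  · linarith [(ht i).2, hM i k]

namespace IsCentredTriangle

variable {v u : Fin 3 → EuclideanSpace ℝ (Fin 2)}

theorem le_xi_sub (h : IsCentredTriangle v u) :
    9 ≤ xi (polarBody (convexHull ℝ (Set.range v)))
      (convexHull ℝ (Set.range v) - convexHull ℝ (Set.range v)) := by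
  set K := convexHull ℝ (Set.range v)
  obtain ⟨q, hq, hlen⟩ :=
    exists_closedLength_eq_xi (by norm_num) h.isConvexBody.sub h.isConvexBody_polarBody
  rw [← hlen]
  by_contra! hlt
  have hN : ∀ d i, inner ℝ (u i) d ≤ finslerNorm (polarBody K) d := fun d i =>
    h.isConvexBody_polarBody.inner_le_finslerNorm (h.normal_mem_polarBody i) d
  rw [closedLength, Fin.sum_univ_three] at hlt
  obtain ⟨t, ht0, ht⟩ := exists_translate_abs_lt (a := fun i k => inner ℝ (u i) (q k))
    (N := fun k => finslerNorm (polarBody K) (q (finRotate 3 k) - q k))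
    (fun k => h.sum_inner (q k))
    (fun i => by rw [← inner_sub_right]; exact hN (q 1 - q 0) i)
    (fun i => by rw [← inner_sub_right]; exact hN (q 2 - q 1) i)
    (fun i => by rw [← inner_sub_right]; exact hN (q 0 - q 2) i) hlt
  obtain ⟨w, hw⟩ := h.exists_inner_eq t ht0
  refine mem_nonFitting.1 hq ⟨-w, fun k => h.mem_interior_sub fun i => ?_⟩
  rw [sub_neg_eq_add, inner_add_right, hw]
  exact ht i k

theorem xi_pos (h : IsCentredTriangle v u) :
    0 < xi (polarBody (convexHull ℝ (Set.range v))) (convexHull ℝ (Set.range v)) := by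
  have h1 := h.le_xi_sub
  have h2 := xi_sub_le (by norm_num) h.isConvexBody h.isConvexBody_polarBody
  push_cast at h2
  linarith

theorem xi_sub_eq (h : IsCentredTriangle v u) :
    xi (polarBody (convexHull ℝ (Set.range v)))
      (convexHull ℝ (Set.range v) - convexHull ℝ (Set.range v)) =
      3 * xi (polarBody (convexHull ℝ (Set.range v))) (convexHull ℝ (Set.range v)) := by
  have h1 := h.le_xi_sub
  have h2 := xi_sub_le (by norm_num) h.isConvexBody h.isConvexBody_polarBody
  have h3 := h.xi_le
  push_cast at h2
  linarith

end IsCentredTriangle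

/-! ### Explicit and equilateral centred triangles -/

theorem exists_isCentredTriangle : ∃ v u, IsCentredTriangle v u := by
  refine ⟨![!₂[1, 0], !₂[0, 1], !₂[-1, -1]], ![!₂[-2, 1], !₂[1, -2], !₂[1, 1]], ?_, ?_, ?_, ?_, ?_⟩
  · ext i; fin_cases i <;> simp
  · ext i
    fin_cases i
    · show (-2 : ℝ) + 1 + 1 = 0
      norm_num
    · show (1 : ℝ) + -2 + 1 = 0
      norm_num
  · intro i; fin_cases i <;> norm_num [PiLp.inner_apply, Fin.sum_univ_two]
  · intro i j hij
    fin_cases i <;> fin_cases j <;> first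
      | exact absurd rfl hij
      | norm_num [PiLp.inner_apply, Fin.sum_univ_two]
  · intro x hx
    have h0 := hx 0
    have h1 := hx 1
    simp [PiLp.inner_apply, Fin.sum_univ_two] at h0 h1
    ext i
    fin_cases i
    · simp; linarith
    · simp; linarith

/-- In the plane, only the origin is orthogonal to two vectors with nonzero Gram determinant. -/
theorem eq_zero_of_inner_eq_zero {a b x : EuclideanSpace ℝ (Fin 2)}
    (hab : inner ℝ a a * inner ℝ b b - inner ℝ a b ^ 2 ≠ (0 : ℝ))
    (ha : inner ℝ a x = (0 : ℝ)) (hb : inner ℝ b x = (0 : ℝ)) : x = 0 := by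
  simp only [PiLp.inner_apply, Fin.sum_univ_two, RCLike.inner_apply, conj_trivial] at hab ha hb
  have hdet : a 0 * b 1 - a 1 * b 0 ≠ 0 := fun h => hab (by
    linear_combination (a 0 * b 1 - a 1 * b 0) * h)
  ext i
  fin_cases i
  · refine (mul_eq_zero.1 ?_).resolve_left hdet
    simp only [Fin.zero_eta]
    linear_combination b 1 * ha - a 1 * hb
  · refine (mul_eq_zero.1 ?_).resolve_left hdet
    simp only [Fin.mk_one]
    linear_combination a 0 * hb - b 0 * ha

theorem isCentredTriangle_of_equilateral {s : Affine.Triangle ℝ (EuclideanSpace ℝ (Fin 2))}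
    (hs : s.Equilateral) (h0 : s.centroid = 0) :
    ∃ u, IsCentredTriangle s.points u := by
  set v := s.points with hv
  have hsum : v 0 + v 1 + v 2 = 0 := by
    have h := s.centroid_eq_smul_sum_vsub_vadd 0
    rw [h0, Fin.sum_univ_three] at h
    simp only [vsub_eq_sub, vadd_eq_add, ← hv] at h
    have h3 := congrArg (fun x => (3 : ℝ) • x) h
    simp only [smul_zero] at h3
    rw [h3]
    push_cast
    module
  obtain ⟨r, hr⟩ := hs
  have hr0 : r ≠ 0 := by
    rw [← hr 0 1 (by decide)]
    exact dist_ne_zero.2 (s.independent.injective.ne (by decide))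
  have hsq : ∀ i j, i ≠ j → inner ℝ (v i - v j) (v i - v j) = r ^ 2 := fun i j hij => by
    rw [real_inner_self_eq_norm_sq, ← dist_eq_norm, hr i j hij]
  have h01 := hsq 0 1 (by decide)
  have h02 := hsq 0 2 (by decide)
  have h12 := hsq 1 2 (by decide)
  have s0 : inner ℝ (v 0) (v 0 + v 1 + v 2) = (0 : ℝ) := by rw [hsum, inner_zero_right]
  have s1 : inner ℝ (v 1) (v 0 + v 1 + v 2) = (0 : ℝ) := by rw [hsum, inner_zero_right]
  have s2 : inner ℝ (v 2) (v 0 + v 1 + v 2) = (0 : ℝ) := by rw [hsum, inner_zero_right]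
  simp only [inner_sub_left, inner_sub_right, inner_add_right] at h01 h02 h12 s0 s1 s2
  rw [real_inner_comm (v 0) (v 1)] at h01 s1
  rw [real_inner_comm (v 0) (v 2)] at h02 s2
  rw [real_inner_comm (v 1) (v 2)] at h12 s2
  -- Three side lengths and three centroid relations determine the six inner products.
  have i00 : inner ℝ (v 0) (v 0) = r ^ 2 / 3 := by linarith
  have i11 : inner ℝ (v 1) (v 1) = r ^ 2 / 3 := by linarith
  have i22 : inner ℝ (v 2) (v 2) = r ^ 2 / 3 := by linarith
  have i01 : inner ℝ (v 0) (v 1) = -(r ^ 2 / 6) := by linarith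
  have i02 : inner ℝ (v 0) (v 2) = -(r ^ 2 / 6) := by linarith
  have i12 : inner ℝ (v 1) (v 2) = -(r ^ 2 / 6) := by linarith
  have i10 := (real_inner_comm (v 0) (v 1)).trans i01
  have i20 := (real_inner_comm (v 0) (v 2)).trans i02
  have i21 := (real_inner_comm (v 1) (v 2)).trans i12
  have hself : ∀ i, inner ℝ (v i) (v i) = r ^ 2 / 3 := by
    intro i
    fin_cases i
    exacts [i00, i11, i22]
  have hne : ∀ i j, i ≠ j → inner ℝ (v i) (v j) = -(r ^ 2 / 6) := by
    intro i j hij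
    fin_cases i <;> fin_cases j <;> first | exact absurd rfl hij | assumption
  -- The factor turns `r ^ 2 / 3` into `-2` and `-(r ^ 2 / 6)` into `1`.
  refine ⟨fun i => (-6 / r ^ 2) • v i, hsum, ?_, fun i => ?_, fun i j hij => ?_, fun x hx => ?_⟩
  · rw [← smul_add, ← smul_add, hsum, smul_zero]
  · rw [real_inner_smul_left, hself]
    field_simp
    norm_num
  · rw [real_inner_smul_left, hne i j hij]
    field_simp
  · have hx' : ∀ i, inner ℝ (v i) x = (0 : ℝ) := fun i => by
      have h := hx i
      rw [real_inner_smul_left] at h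
      exact (mul_eq_zero.1 h).resolve_left (div_ne_zero (by norm_num) (pow_ne_zero 2 hr0))
    refine eq_zero_of_inner_eq_zero (a := v 0) (b := v 1) ?_ (hx' 0) (hx' 1)
    rw [i00, i11, i01]
    have : r ^ 2 / 3 * (r ^ 2 / 3) - (-(r ^ 2 / 6)) ^ 2 = r ^ 4 / 12 := by ring
    rw [this]
    exact div_ne_zero (pow_ne_zero 4 hr0) (by norm_num)

end FinslerBilliard

theorem mainTheorem2 :
    -- the minima are attained and the estimate holds, in every dimension
    (∀ n : ℕ, 1 ≤ n → ∀ K T : Set (EuclideanSpace ℝ (Fin n)),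
      FinslerBilliard.IsConvexBody K → FinslerBilliard.IsConvexBody T →
        IsLeast (FinslerBilliard.lengthSet T K) (FinslerBilliard.xi T K) ∧
        IsLeast (FinslerBilliard.lengthSet T (K - K)) (FinslerBilliard.xi T (K - K)) ∧
        FinslerBilliard.xi T (K - K) ≤ ((n : ℝ) + 1) * FinslerBilliard.xi T K) ∧
    -- in the plane the constant `3` is the best possible
    IsLeast {c : ℝ | ∀ K T : Set (EuclideanSpace ℝ (Fin 2)),
      FinslerBilliard.IsConvexBody K → FinslerBilliard.IsConvexBody T →
        FinslerBilliard.xi T (K - K) ≤ c * FinslerBilliard.xi T K} 3 ∧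
    -- equality for an equilateral triangle `K` centred at the origin and `T = K°`
    (∀ (s : Affine.Triangle ℝ (EuclideanSpace ℝ (Fin 2))) (K : Set (EuclideanSpace ℝ (Fin 2))),
      s.Equilateral → s.centroid = 0 → K = convexHull ℝ (Set.range s.points) →
        FinslerBilliard.IsConvexBody K ∧
        FinslerBilliard.IsConvexBody (FinslerBilliard.polarBody K) ∧
        0 < FinslerBilliard.xi (FinslerBilliard.polarBody K) K ∧
        FinslerBilliard.xi (FinslerBilliard.polarBody K) (K - K) =
          3 * FinslerBilliard.xi (FinslerBilliard.polarBody K) K) := by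
  refine ⟨fun n hn K T hK hT => ⟨FinslerBilliard.isLeast_xi hn hK hT,
    FinslerBilliard.isLeast_xi hn hK.sub hT, FinslerBilliard.xi_sub_le hn hK hT⟩,
    ⟨fun K T hK hT => ?_, fun c hc => ?_⟩, ?_⟩
  · have h := FinslerBilliard.xi_sub_le (by norm_num) hK hT
    norm_num at h
    exact h
  · obtain ⟨v, u, h⟩ := FinslerBilliard.exists_isCentredTriangle
    have hle := hc _ _ h.isConvexBody h.isConvexBody_polarBody
    rw [h.xi_sub_eq] at hle
    exact le_of_mul_le_mul_right hle h.xi_pos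
  · rintro s K hs h0 rfl
    obtain ⟨u, h⟩ := FinslerBilliard.isCentredTriangle_of_equilateral hs h0
    exact ⟨h.isConvexBody, h.isConvexBody_polarBody, h.xi_pos, h.xi_sub_eq⟩
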